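/- \textbf{Product forms.} Regard the positive reals as a real vector space with addition $a\oplus b=ab$ and scalar multiplication $r\odot a=a^{r}$. Let $M$ be an $m$-dimensional smooth manifold and $n\ge 0$. An \emph{$n$-product form} on $M$ assigns to each point $x$ an alternating $n$-linear map from $T_xM$ to this vector space; in local coordinates it is written $\alpha=\prod_I (A_I)^{dx^I}$ with positive functions $A_I$, where $I$ runs over the increasing multi-indices of length $n$, and it is assumed smooth, i.e. the $A_I$ are smooth. Write $\ln\alpha=\sum_I \ln(A_I)\,dx^I$, an ordinary differential $n$-form, and conversely $\exp\big(\sum_I a_I\,dx^I\big)=\prod_I (e^{a_I})^{dx^I}$. The \emph{product differential} of $\alpha$ is the $(n+1)$-product form $q\alpha=\exp(d\ln\alpha)$, where $d$ is the exterior derivative. \textbf{Simplices and chains.} Let $\bar s^{k}=\{x\in\mathbb R^{k}: x^i\ge 0,\ \sum_i x^i\le 1\}$ be the standard $k$-simplex with vertices $R_0=0$ and $R_1,\dots,R_k$ the standard basis vectors. A $k$-simplex in $M$ is a map $\sigma$ into $M$ that is smooth on an open neighbourhood of $\bar s^{k}$ in $\mathbb R^{k}$. A $k$-chain is a finite formal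 sum $c=\sum_i a_i\sigma_i$ of $k$-simplices with real coefficients. The boundary of a simplex is $\partial\sigma=\sum_{j=0}^{k}(-1)^j\,\sigma|_{(R_0,\dots,\hat R_j,\dots,R_k)}$, each face being parametrized by $\bar s^{k-1}$ through the affine map that preserves the order of the vertices, and $\partial c=\sum_i a_i\,\partial\sigma_i$. \textbf{Product integrals.} For a positive function $A$ on $\bar s^{k}$, the product integral $\prod_{\bar s^{k}}A^{dx^1\cdots dx^k}$ is the limit, if it exists and is positive, of the Riemann products $\prod_l A(c_l)^{\Delta_l}$ over tagged partitions of the unit cube into boxes of volume $\Delta_l$ with tags $c_l$ in the closed boxes, as the mesh tends to $0$ (with $A$ extended by $1$ outside $\bar s^{k}$). For a $k$-product form $\alpha$ and a $k$-simplex $\sigma$ in $M$, let $A$ be the coefficient of the pullback $\sigma^{*}\alpha=(A)^{dx^1\cdots dx^k}$ and put $\prod_\sigma\alpha=\prod_{\bar s^{k}}A^{dx^1\cdots dx^k}$; for a chain put $\prod_{\sum_i a_i\sigma_i}\alpha=\prod_i\big(\prod_{\sigma_i}\alpha\big)^{a_i}$. \textbf{Theorem (Stokes' theorem for product integrals).}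 Let $M$ be an $m$-dimensional smooth manifold, $c=\sum_i a_i\sigma_i$ an $(n+1)$-chain in $M$ with real coefficients $a_i$, and $\alpha$ a smooth $n$-product form on $M$. Then the product integrals of $\alpha$ over all simplices of $\partial c$ and of $q\alpha$ over all simplices of $c$ exist, and $$\prod_{\partial c}\alpha=\prod_{c}q\alpha .$$ -/

import Mathlib

open scoped Manifold ContDiff Topology

namespace ProductCalculus

noncomputable section

/-! ### The positive reals as a real vector space -/

/-- The positive real numbers, regarded as a one-dimensional real vector space:
vector addition is multiplication `a ⊕ b = a b`, the zero vector is `1`, and scalar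
multiplication is `r ⊙ a = a ^ r`.  In Lean these operations are written `+`, `0` and `•`. -/
@[ext]
structure PosReal where
  val : ℝ
  pos : 0 < val

namespace PosReal

instance : Zero PosReal := ⟨⟨1, one_pos⟩⟩
instance : Add PosReal := ⟨fun a b => ⟨a.val * b.val, mul_pos a.pos b.pos⟩⟩
instance : Neg PosReal := ⟨fun a => ⟨a.val⁻¹, inv_pos.mpr a.pos⟩⟩
instance : SMul ℝ PosReal := ⟨fun r a => ⟨a.val ^ r, Real.rpow_pos_of_pos a.pos r⟩⟩

@[simp] theorem zero_val : (0 : PosReal).val = 1 := rfl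
@[simp] theorem add_val (a b : PosReal) : (a + b).val = a.val * b.val := rfl
@[simp] theorem neg_val (a : PosReal) : (-a).val = a.val⁻¹ := rfl
@[simp] theorem smul_val (r : ℝ) (a : PosReal) : (r • a).val = a.val ^ r := rfl

instance : AddCommGroup PosReal where
  add_assoc a b c := by ext; simp [mul_assoc]
  zero_add a := by ext; simp
  add_zero a := by ext; simp
  add_comm a b := by ext; simp [mul_comm]
  neg_add_cancel a := by ext; simp [a.pos.ne']
  nsmul := nsmulRec
  zsmul := zsmulRec

instance : Module ℝ PosReal where
  one_smul a := by ext; simp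
  mul_smul r s a := by ext; simp [mul_comm r s, Real.rpow_mul a.pos.le]
  smul_zero r := by ext; simp
  smul_add r a b := by ext; simp [Real.mul_rpow a.pos.le b.pos.le]
  add_smul r s a := by ext; simp [Real.rpow_add a.pos]
  zero_smul a := by ext; simp

/-- The usual topology of `(0, ∞)`. -/
instance : TopologicalSpace PosReal := TopologicalSpace.induced PosReal.val inferInstance

theorem continuous_val : Continuous PosReal.val := continuous_induced_dom

/-- The logarithm, a continuous linear map from the positive reals to `ℝ`. -/
def ln : PosReal →L[ℝ] ℝ where
  toFun a := Real.log a.val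
  map_add' a b := Real.log_mul a.pos.ne' b.pos.ne'
  map_smul' r a := Real.log_rpow a.pos r
  cont := continuous_val.log fun a => a.pos.ne'

/-- The exponential, a continuous linear map from `ℝ` to the positive reals. -/
def exp : ℝ →L[ℝ] PosReal where
  toFun t := ⟨Real.exp t, Real.exp_pos t⟩
  map_add' s t := by ext; exact Real.exp_add s t
  map_smul' r t := by
    ext
    simp [mul_comm r t, Real.exp_mul]
  cont := continuous_induced_rng.mpr Real.continuous_exp

end PosReal

/-! ### Differential forms and product forms on a manifold -/

section Forms

variable (m : ℕ) (M : Type*) [TopologicalSpace M] [ChartedSpace (EuclideanSpace ℝ (Fin m)) M]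

/-- A (not necessarily smooth) differential `n`-form on the `m`-dimensional manifold `M`. -/
abbrev DiffForm (n : ℕ) := ∀ x : M, TangentSpace (𝓡 m) x [⋀^Fin n]→L[ℝ] ℝ

/-- A (not necessarily smooth) `n`-product form on the `m`-dimensional manifold `M`: at every point
an alternating `n`-linear map from the tangent space to the vector space of positive reals.
In coordinates, `∏_I (A_I)^{dx^I}` with `A_I > 0` is the map
`(v_1, …, v_n) ↦ ∏_I A_I ^ (dx^I (v_1, …, v_n))`, and the pointwise `+` and `•` are the
operations `⊕` and `⊙` on the coefficients. -/
abbrev ProductForm (n : ℕ) := ∀ x : M, TangentSpace (𝓡 m) x [⋀^Fin n]→L[ℝ] PosReal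

end Forms

section Calculus

variable {m : ℕ} {M : Type*} [TopologicalSpace M] [ChartedSpace (EuclideanSpace ℝ (Fin m)) M]

/-- The expression of a differential form in the preferred coordinates around `x₀`: its pullback
under the inverse of the chart.  (Meaningful on the image of the chart only.) -/
def DiffForm.inChart {n : ℕ} (η : DiffForm m M n) (x₀ : M) :
    EuclideanSpace ℝ (Fin m) → EuclideanSpace ℝ (Fin m) [⋀^Fin n]→L[ℝ] ℝ :=
  fun y => (η ((extChartAt (𝓡 m) x₀).symm y)).compContinuousLinearMap
    (mfderiv 𝓘(ℝ, EuclideanSpace ℝ (Fin m)) (𝓡 m) (extChartAt (𝓡 m) x₀).symm y)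

/-- A differential form is smooth if it is so in coordinates. -/
def DiffForm.IsSmooth {n : ℕ} (η : DiffForm m M n) : Prop :=
  ∀ x₀ : M, ContDiffOn ℝ ∞ (DiffForm.inChart η x₀) (extChartAt (𝓡 m) x₀).target

/-- The exterior derivative on a manifold, computed at `x` in the preferred coordinates
around `x`. -/
def DiffForm.d {n : ℕ} (η : DiffForm m M n) : DiffForm m M (n + 1) :=
  fun x => (extDeriv (DiffForm.inChart η x) (extChartAt (𝓡 m) x x)).compContinuousLinearMap
    (mfderiv (𝓡 m) 𝓘(ℝ, EuclideanSpace ℝ (Fin m)) (extChartAt (𝓡 m) x) x)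

/-- The product form `exp η`; in coordinates `exp (∑_I a_I dx^I) = ∏_I (exp a_I)^{dx^I}`. -/
def DiffForm.exp {n : ℕ} (η : DiffForm m M n) : ProductForm m M n :=
  fun x => PosReal.exp.compContinuousAlternatingMap (η x)

/-- The differential form `ln α`; in coordinates `ln (∏_I (A_I)^{dx^I}) = ∑_I ln A_I dx^I`. -/
def ProductForm.ln {n : ℕ} (α : ProductForm m M n) : DiffForm m M n :=
  fun x => PosReal.ln.compContinuousAlternatingMap (α x)

/-- A product form `∏_I (A_I)^{dx^I}` is smooth if all `ln A_I`, equivalently all the positive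
functions `A_I`, are smooth in coordinates. -/
def ProductForm.IsSmooth {n : ℕ} (α : ProductForm m M n) : Prop :=
  DiffForm.IsSmooth (ProductForm.ln α)

/-- The product differential `q α = exp (d (ln α))`. -/
def ProductForm.q {n : ℕ} (α : ProductForm m M n) : ProductForm m M (n + 1) :=
  DiffForm.exp (DiffForm.d (ProductForm.ln α))

/-- The pullback `φ^{*p} α` of an `n`-product form under a map from `ℝ^k` to `M`; in coordinates
`(A)^{dy^i} ↦ (A ∘ φ)^{(∂y^i/∂x^j) dx^j}`, and so on. -/
def ProductForm.pullback {k n : ℕ} (φ : (Fin k → ℝ) → M) (α : ProductForm m M n) :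
    (Fin k → ℝ) → (Fin k → ℝ) [⋀^Fin n]→L[ℝ] PosReal :=
  fun x => (α (φ x)).compContinuousLinearMap (mfderiv 𝓘(ℝ, Fin k → ℝ) (𝓡 m) φ x)

end Calculus

/-! ### Product integrals over the standard simplex -/

/-- The standard `n`-simplex in `ℝ^n`: all `x` with `x^i ≥ 0` and `∑ x^i ≤ 1`. -/
def stdSimplex (n : ℕ) : Set (Fin n → ℝ) := {x | (∀ i, 0 ≤ x i) ∧ ∑ i, x i ≤ 1}

/-- The unit box, which contains the standard simplex. -/
def unitBox (n : ℕ) : BoxIntegral.Box (Fin n) where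
  lower := 0
  upper := 1
  lower_lt_upper _ := one_pos

open Classical in
/-- The Riemann product `∏_k A(c_k)^{Δ_k}` of a positive function `A` over the standard simplex,
for a partition of the unit box into boxes of volume `Δ_k` with tags `c_k`; tags outside of the
simplex contribute the factor `1`. -/
def riemannProd {n : ℕ} (A : (Fin n → ℝ) → PosReal)
    (π : BoxIntegral.TaggedPrepartition (unitBox n)) : ℝ :=
  ∏ J ∈ π.boxes,
    (if π.tag J ∈ stdSimplex n then (A (π.tag J)).val else 1) ^ MeasureTheory.volume.real (J : Set (Fin n → ℝ))

/-- The filter of tagged partitions of the unit box, each tag lying in its own closed box, as the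
largest diameter of a box tends to zero. -/
def meshToZero (n : ℕ) : Filter (BoxIntegral.TaggedPrepartition (unitBox n)) :=
  BoxIntegral.IntegrationParams.Riemann.toFilteriUnion (unitBox n) ⊤

/-- `A` is product integrable over the standard simplex: its Riemann products converge to a
positive real number. -/
def ProdIntegrable {n : ℕ} (A : (Fin n → ℝ) → PosReal) : Prop :=
  ∃ P : ℝ, 0 < P ∧ Filter.Tendsto (riemannProd A) (meshToZero n) (𝓝 P)

/-- The product integral `∏ A(x)^{dx^1 ⋯ dx^n}` over the standard simplex, the limit of the
Riemann products. -/
def prodIntegral {n : ℕ} (A : (Fin n → ℝ) → PosReal) : ℝ :=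
  Filter.limUnder (meshToZero n) (riemannProd A)

/-! ### Simplices and chains in a manifold -/

/-- The vertices `R_0 = 0`, `R_1 = (1, 0, …, 0)`, …, `R_n = (0, …, 0, 1)`. -/
def stdVertex (n : ℕ) : Fin (n + 1) → (Fin n → ℝ) :=
  Fin.cons 0 fun j => Pi.single j 1

/-- The affine map from `ℝ^n` to `ℝ^k` that sends the vertices `R_0, …, R_n` of the standard
simplex to `P_0, …, P_n`; it parametrizes the ordered simplex `(P_0, …, P_n)`. -/
def affineSimplex {n k : ℕ} (P : Fin (n + 1) → (Fin k → ℝ)) (x : Fin n → ℝ) : Fin k → ℝ :=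
  (1 - ∑ j, x j) • P 0 + ∑ j, x j • P j.succ

/-- The parametrization of the face `(R_0, …, R̂_i, …, R_{n+1})` of the standard simplex. -/
def faceMap {n : ℕ} (i : Fin (n + 2)) : (Fin n → ℝ) → (Fin (n + 1) → ℝ) :=
  affineSimplex fun j => stdVertex (n + 1) (i.succAbove j)

theorem contDiff_faceMap {n : ℕ} (i : Fin (n + 2)) : ContDiff ℝ ∞ (faceMap (n := n) i) := by
  unfold faceMap affineSimplex
  fun_prop

theorem stdVertex_mem (n : ℕ) (j : Fin (n + 1)) : stdVertex n j ∈ stdSimplex n := by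
  refine Fin.cases ?_ (fun j => ?_) j
  · simp [stdVertex, stdSimplex]
  · refine ⟨fun i => ?_, ?_⟩
    · simp only [stdVertex, Fin.cons_succ, Pi.single_apply]
      split_ifs <;> norm_num
    · simp [stdVertex]

theorem faceMap_mem {n : ℕ} (i : Fin (n + 2)) {x : Fin n → ℝ} (hx : x ∈ stdSimplex n) :
    faceMap i x ∈ stdSimplex (n + 1) := by
  have hP := fun j => stdVertex_mem (n + 1) (i.succAbove j)
  have h0 : 0 ≤ 1 - ∑ j, x j := by linarith [hx.2]
  refine ⟨fun k => ?_, ?_⟩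
  · simp only [faceMap, affineSimplex, Pi.add_apply, Pi.smul_apply, Finset.sum_apply, smul_eq_mul]
    exact add_nonneg (mul_nonneg h0 ((hP 0).1 k))
      (Finset.sum_nonneg fun j _ => mul_nonneg (hx.1 j) ((hP j.succ).1 k))
  · simp only [faceMap, affineSimplex, Pi.add_apply, Pi.smul_apply, Finset.sum_apply, smul_eq_mul,
      Finset.sum_add_distrib]
    rw [Finset.sum_comm]
    simp only [← Finset.mul_sum]
    have h1 := mul_le_mul_of_nonneg_left (hP 0).2 h0
    have h2 : ∑ j, x j * ∑ k, stdVertex (n + 1) (i.succAbove j.succ) k ≤ ∑ j, x j * 1 :=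
      Finset.sum_le_sum fun j _ => mul_le_mul_of_nonneg_left (hP j.succ).2 (hx.1 j)
    simp only [mul_one] at h1 h2
    linarith

section Chains

variable (m : ℕ) (M : Type*) [TopologicalSpace M] [ChartedSpace (EuclideanSpace ℝ (Fin m)) M]

/-- An `n`-simplex in `M`: a map to `M` that is smooth on an open neighbourhood of the standard
`n`-simplex in `ℝ^n`.  (The values outside of that neighbourhood play no role.) -/
structure Simplex (n : ℕ) where
  toFun : (Fin n → ℝ) → M
  smooth : ∃ W : Set (Fin n → ℝ), IsOpen W ∧ stdSimplex n ⊆ W ∧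
    ContMDiffOn 𝓘(ℝ, Fin n → ℝ) (𝓡 m) ∞ toFun W

/-- An `n`-chain in `M`: a finite formal sum `∑ a_i σ_i` of `n`-simplices with real
coefficients. -/
abbrev Chain (n : ℕ) := Simplex m M n →₀ ℝ

end Chains

variable {m : ℕ} {M : Type*} [TopologicalSpace M] [ChartedSpace (EuclideanSpace ℝ (Fin m)) M]

/-- The `i`-th face of a simplex. -/
def Simplex.face {n : ℕ} (σ : Simplex m M (n + 1)) (i : Fin (n + 2)) : Simplex m M n where
  toFun := σ.toFun ∘ faceMap i
  smooth := by
    obtain ⟨W, hW, hsW, hσ⟩ := σ.smooth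
    refine ⟨faceMap i ⁻¹' W, hW.preimage (contDiff_faceMap i).continuous,
      fun x hx => hsW (faceMap_mem i hx), ?_⟩
    exact hσ.comp (contDiff_faceMap i).contMDiff.contMDiffOn fun x hx => hx

/-- The boundary `∂ (∑ a_i σ_i) = ∑ a_i ∂σ_i`, where `∂σ` is the sum of the faces of `σ` with the
signs `(-1)^j`. -/
def Chain.boundary {n : ℕ} (c : Chain m M (n + 1)) : Chain m M n :=
  c.sum fun σ a => a • ∑ j : Fin (n + 2), Finsupp.single (σ.face j) ((-1 : ℝ) ^ (j : ℕ))

/-- The coefficient `A > 0` of the pullback `σ^{*p} α = (A)^{dx^1 ⋯ dx^n}` of an `n`-product form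
to `ℝ^n`. -/
def Simplex.coeff {n : ℕ} (σ : Simplex m M n) (α : ProductForm m M n) : (Fin n → ℝ) → PosReal :=
  fun x => ProductForm.pullback σ.toFun α x fun i => Pi.single i 1

/-- The `n`-product form `α` is product integrable over the `n`-simplex `σ`. -/
def Simplex.ProdIntegrable {n : ℕ} (σ : Simplex m M n) (α : ProductForm m M n) : Prop :=
  ProductCalculus.ProdIntegrable (σ.coeff α)

/-- The product integral of an `n`-product form over an `n`-simplex in `M`, defined through the
pullback to the standard simplex. -/
def Simplex.prodIntegral {n : ℕ} (σ : Simplex m M n) (α : ProductForm m M n) : ℝ :=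
  ProductCalculus.prodIntegral (σ.coeff α)

/-- The product integral over a chain: over `∑ a_i σ_i` it is `∏_i (∏_{σ_i} α) ^ a_i`. -/
def Chain.prodIntegral {n : ℕ} (c : Chain m M n) (α : ProductForm m M n) : ℝ :=
  c.prod fun σ a => σ.prodIntegral α ^ a

/-- The `n`-product form `α` is product integrable over all the simplices of the chain `c`. -/
def Chain.ProdIntegrable {n : ℕ} (c : Chain m M n) (α : ProductForm m M n) : Prop :=
  ∀ σ ∈ c.support, σ.ProdIntegrable α

end

end ProductCalculus

namespace ProductCalculus

open MeasureTheory Filter Set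

/-! Taking logarithms turns the statement into the ordinary Stokes theorem. A Riemann product of `A`
is the exponential of a Riemann sum of `ln A`, so when `ln A` is continuous on the simplex the
product integral exists and equals the exponential of an ordinary integral (`tendsto_riemannProd`).
Since `ln (q α) = d (ln α)`, and real powers of product integrals become real multiples of
integrals, it remains to prove Stokes for `ln α` on one simplex and extend linearly to chains.

For one simplex, `d` commutes with pullback (`DiffForm.extDeriv_pullback`), which reduces the claim
to a form near the standard simplex. There the fundamental theorem of calculus, applied along each
coordinate, produces an integral over a coordinate face and one over the slanted face opposite the
origin (`setIntegral_fderiv_single`). The slanted contributions of all coordinates add up to the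
single face term of the boundary by `alternating_apply_single_sub_single` and
`setIntegral_insertNth_one_sub_sum`. -/

theorem convex_stdSimplex (n : ℕ) : Convex ℝ (stdSimplex n) := by
  intro x hx y hy a b ha hb hab
  refine ⟨fun i => ?_, ?_⟩
  · exact add_nonneg (mul_nonneg ha (hx.1 i)) (mul_nonneg hb (hy.1 i))
  · simp only [Pi.add_apply, Pi.smul_apply, smul_eq_mul, Finset.sum_add_distrib, ← Finset.mul_sum]
    nlinarith [hx.2, hy.2]

theorem isClosed_stdSimplex (n : ℕ) : IsClosed (stdSimplex n) := by
  have h : stdSimplex n = (⋂ i, {x | 0 ≤ x i}) ∩ {x | ∑ i, x i ≤ 1} := by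
    ext
    simp [stdSimplex]
  rw [h]
  exact (isClosed_iInter fun i => isClosed_le continuous_const (continuous_apply i)).inter
    (isClosed_le (continuous_finsetSum _ fun i _ => continuous_apply i) continuous_const)

theorem stdSimplex_subset_Icc (n : ℕ) : stdSimplex n ⊆ BoxIntegral.Box.Icc (unitBox n) := by
  intro x hx
  refine ⟨hx.1, fun i => ?_⟩
  exact (Finset.single_le_sum (fun j _ => hx.1 j) (Finset.mem_univ i)).trans hx.2

theorem isCompact_stdSimplex (n : ℕ) : IsCompact (stdSimplex n) :=
  (BoxIntegral.Box.isCompact_Icc _).of_isClosed_subset (isClosed_stdSimplex n)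
    (stdSimplex_subset_Icc n)

/-! ### Product integrals as exponentials of ordinary integrals -/

theorem riemannProd_eq_exp_integralSum {n : ℕ} (A : (Fin n → ℝ) → PosReal)
    (π : BoxIntegral.TaggedPrepartition (unitBox n)) :
    riemannProd A π = Real.exp (BoxIntegral.integralSum
      ((stdSimplex n).indicator fun x => PosReal.ln (A x))
      (volume : Measure (Fin n → ℝ)).toBoxAdditive.toSMul π) := by
  rw [riemannProd, BoxIntegral.integralSum, Real.exp_sum]
  refine Finset.prod_congr rfl fun J _ => ?_
  by_cases h : π.tag J ∈ stdSimplex n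
  · rw [if_pos h, Real.rpow_def_of_pos (A _).pos, indicator_of_mem h]
    simp [PosReal.ln, mul_comm]
  · simp [h]

/-- This is Lebesgue's criterion followed by `Real.exp`: the extension of `ln A` by zero is bounded
and can be discontinuous only on the frontier of the simplex, which is null because the simplex is
convex. -/
theorem tendsto_riemannProd {n : ℕ} {A : (Fin n → ℝ) → PosReal}
    (hA : ContinuousOn (fun x => PosReal.ln (A x)) (stdSimplex n)) :
    Tendsto (riemannProd A) (meshToZero n)
      (𝓝 (Real.exp (∫ x in stdSimplex n, PosReal.ln (A x)))) := by
  set f := fun x => PosReal.ln (A x)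
  have hb : ∃ C : ℝ, ∀ x ∈ BoxIntegral.Box.Icc (unitBox n),
      ‖(stdSimplex n).indicator f x‖ ≤ C := by
    obtain ⟨C, hC⟩ := (isCompact_stdSimplex n).exists_bound_of_continuousOn hA
    refine ⟨max C 0, fun x _ => ?_⟩
    by_cases h : x ∈ stdSimplex n
    · simpa [h] using Or.inl (hC x h)
    · simp [h]
  have hc : ∀ᵐ x ∂(volume : Measure (Fin n → ℝ)),
      ContinuousAt ((stdSimplex n).indicator f) x := by
    have h0 : ∀ᵐ x ∂(volume : Measure (Fin n → ℝ)), x ∉ frontier (stdSimplex n) :=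
      measure_eq_zero_iff_ae_notMem.mp ((convex_stdSimplex n).addHaar_frontier _)
    filter_upwards [h0] with x hx
    exact (hA.mono interior_subset).continuousAt_indicator hx
  have := AEContinuous.hasBoxIntegral volume hb hc
    BoxIntegral.IntegrationParams.Riemann
  -- A box, as a set, is half-open and misses the coordinate faces of the simplex; passing to the
  -- closed box changes only a null set.
  have hI : ∫ x in (unitBox n : Set (Fin n → ℝ)), (stdSimplex n).indicator f x =
      ∫ x in stdSimplex n, f x := by
    rw [setIntegral_congr_set (unitBox n).coe_ae_eq_Icc,
      setIntegral_indicator (isClosed_stdSimplex n).measurableSet,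
      inter_eq_right.mpr (stdSimplex_subset_Icc n)]
  rw [hI] at this
  refine ((Real.continuous_exp.tendsto _).comp this).congr fun π => ?_
  exact (riemannProd_eq_exp_integralSum A π).symm

theorem prodIntegrable_of_continuousOn {n : ℕ} {A : (Fin n → ℝ) → PosReal}
    (hA : ContinuousOn (fun x => PosReal.ln (A x)) (stdSimplex n)) : ProdIntegrable A :=
  ⟨_, Real.exp_pos _, tendsto_riemannProd hA⟩

theorem prodIntegral_eq_exp {n : ℕ} {A : (Fin n → ℝ) → PosReal}
    (hA : ContinuousOn (fun x => PosReal.ln (A x)) (stdSimplex n)) :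
    prodIntegral A = Real.exp (∫ x in stdSimplex n, PosReal.ln (A x)) := by
  -- Without this the limit would not be unique, and `limUnder` could not be evaluated.
  have : (meshToZero n).NeBot :=
    BoxIntegral.IntegrationParams.toFilteriUnion_neBot _ _ _
  exact (tendsto_riemannProd hA).limUnder_eq

/-! ### Faces of the standard simplex and their edge vectors -/

theorem faceMap_succ {n : ℕ} (i : Fin (n + 1)) (x : Fin n → ℝ) :
    faceMap i.succ x = i.insertNth (0 : ℝ) x := by
  ext k
  simp only [faceMap, affineSimplex, Fin.succ_succAbove_zero, Fin.succ_succAbove_succ, stdVertex,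
    Fin.cons_zero, Fin.cons_succ]
  refine i.succAboveCases ?_ (fun l => ?_) k
  · simp [(Fin.succAbove_ne i _).symm]
  · simp [Pi.single_apply]

/-- The first remaining vertex is `R_1`, so the barycentric weight `1 - ∑ x^j` lands in coordinate
`0`: the slanted face is a graph over the other coordinates. -/
theorem faceMap_zero {n : ℕ} (x : Fin n → ℝ) :
    faceMap 0 x = (0 : Fin (n + 1)).insertNth (1 - ∑ j, x j) x := by
  ext k
  simp only [faceMap, affineSimplex, Fin.zero_succAbove, stdVertex, Fin.cons_succ]
  refine Fin.cases ?_ (fun l => ?_) k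
  · simp [(Fin.succ_ne_zero _).symm]
  · simp [Pi.single_apply, Fin.succ_ne_zero]

theorem fderiv_faceMap {n : ℕ} (i : Fin (n + 2)) (x : Fin n → ℝ) (k : Fin n) :
    fderiv ℝ (faceMap i) x (Pi.single k 1) =
      stdVertex (n + 1) (i.succAbove k.succ) - stdVertex (n + 1) (i.succAbove 0) := by
  have h : HasFDerivAt (faceMap i)
      ((-∑ j, ContinuousLinearMap.proj (R := ℝ) (φ := fun _ : Fin n => ℝ) j).smulRight
        (stdVertex (n + 1) (i.succAbove 0)) +
      ∑ j : Fin n, (ContinuousLinearMap.proj (R := ℝ) (φ := fun _ : Fin n => ℝ) j).smulRight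
        (stdVertex (n + 1) (i.succAbove j.succ))) x := by
    have hp := fun j : Fin n => hasFDerivAt_apply (𝕜 := ℝ) (F' := fun _ => ℝ) j x
    exact ((HasFDerivAt.fun_sum fun j _ => hp j).const_sub 1).smul_const _ |>.add
      (HasFDerivAt.fun_sum fun j _ => (hp j).smul_const _)
  rw [h.fderiv]
  ext l
  simp [Pi.single_apply]
  ring

theorem fderiv_faceMap_succ {n : ℕ} (i : Fin (n + 1)) (x : Fin n → ℝ) (k : Fin n) :
    fderiv ℝ (faceMap i.succ) x (Pi.single k 1) = Pi.single (i.succAbove k) 1 := by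
  simp [fderiv_faceMap, stdVertex]

theorem fderiv_faceMap_zero {n : ℕ} (x : Fin n → ℝ) (k : Fin n) :
    fderiv ℝ (faceMap 0) x (Pi.single k 1) =
      Pi.single (M := fun _ : Fin (n + 1) => ℝ) k.succ 1 - Pi.single 0 1 := by
  simp only [fderiv_faceMap, Fin.zero_succAbove, stdVertex, Fin.cons_succ]

/-- The value of an alternating form on the edges of the face opposite to the origin. -/
theorem alternating_apply_single_sub_single {n : ℕ} (φ : (Fin (n + 1) → ℝ) [⋀^Fin n]→L[ℝ] ℝ) :
    φ (fun k => Pi.single k.succ 1 - Pi.single 0 1) =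
      ∑ i : Fin (n + 1), (-1 : ℝ) ^ (i : ℕ) * φ fun k => Pi.single (i.succAbove k) 1 := by
  -- The covector `l` is `1` on every basis vector, hence `0` on every edge of the slanted face. The
  -- top-degree form `ψ = l ∧ φ` is evaluated on two frames of determinant `1`: on `v` only one term
  -- survives, on the standard basis all do.
  let l : (Fin (n + 1) → ℝ) →L[ℝ] ℝ := ∑ j, ContinuousLinearMap.proj j
  have hl : ∀ k, l (Pi.single k 1) = 1 := fun k => by simp [l, Pi.single_apply]
  let ψ := ContinuousAlternatingMap.alternatizeUncurryFin (l.smulRight φ)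
  let v : Fin (n + 1) → Fin (n + 1) → ℝ :=
    Fin.cons (Pi.single 0 1) fun k => Pi.single k.succ 1 - Pi.single 0 1
  have h1 : ψ v = φ (fun k => Pi.single k.succ 1 - Pi.single 0 1) := by
    simp only [ψ, ContinuousAlternatingMap.alternatizeUncurryFin_apply, Fin.sum_univ_succ,
      ContinuousLinearMap.smulRight_apply, v, Fin.cons_zero, Fin.cons_succ, map_sub, hl]
    simp [Fin.removeNth_zero]
  have h2 : ψ (fun k => Pi.single k 1) =
      ∑ i : Fin (n + 1), (-1 : ℝ) ^ (i : ℕ) * φ fun k => Pi.single (i.succAbove k) 1 := by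
    simp only [ψ, ContinuousAlternatingMap.alternatizeUncurryFin_apply,
      ContinuousLinearMap.smulRight_apply, hl]
    simp only [zsmul_eq_mul, Int.cast_pow, Int.cast_neg, Int.cast_one,
      one_smul]
    rfl
  -- The frame `v` arises from the standard basis by subtracting row `0` from every other row.
  have h3 : (Pi.basisFun ℝ (Fin (n + 1))).det v = 1 := by
    rw [Pi.basisFun_det_apply, ← Matrix.det_one (n := Fin (n + 1)) (R := ℝ)]
    refine Matrix.det_eq_of_forall_row_eq_smul_add_const
      (Fin.cons 0 fun _ => -1 : Fin (n + 1) → ℝ) 0 (by simp) fun i j => ?_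
    refine Fin.cases ?_ (fun i => ?_) i
    · simp [v, Matrix.one_apply, Pi.single_apply, eq_comm]
    · simp [v, Matrix.one_apply, Pi.single_apply, eq_comm, sub_eq_add_neg]
      split_ifs <;> simp
  have h4 := congrArg (fun f => f v)
    (ψ.toAlternatingMap.eq_smul_basis_det (Pi.basisFun ℝ (Fin (n + 1))))
  simp only [AlternatingMap.smul_apply, h3, smul_eq_mul, mul_one] at h4
  rw [← h1, ← h2]
  have h5 : ⇑(Pi.basisFun ℝ (Fin (n + 1))) = fun k => Pi.single k 1 := by
    ext i j
    simp
  rw [h5] at h4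
  exact h4

/-! ### Integration over the standard simplex -/

theorem insertNth_mem_stdSimplex {n : ℕ} {i : Fin (n + 1)} {t : ℝ} {y : Fin n → ℝ} :
    i.insertNth t y ∈ stdSimplex (n + 1) ↔ y ∈ stdSimplex n ∧ t ∈ Icc 0 (1 - ∑ j, y j) := by
  simp only [stdSimplex, mem_ofPred_eq, Fin.forall_iff_succAbove i, Fin.insertNth_apply_same,
    Fin.insertNth_apply_succAbove, Fin.sum_univ_succAbove _ i, mem_Icc]
  constructor
  · rintro ⟨⟨h1, h2⟩, h3⟩
    exact ⟨⟨h2, by linarith⟩, h1, by linarith⟩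
  · rintro ⟨⟨h1, h2⟩, h3, h4⟩
    exact ⟨⟨h3, h1⟩, by linarith⟩

/-- Fubini's theorem over the standard simplex, slicing along the `i`-th coordinate. -/
theorem setIntegral_stdSimplex_succ {n : ℕ} (i : Fin (n + 1)) {g : (Fin (n + 1) → ℝ) → ℝ}
    (hg : ContinuousOn g (stdSimplex (n + 1))) :
    ∫ x in stdSimplex (n + 1), g x =
      ∫ y in stdSimplex n, ∫ t in (0 : ℝ)..(1 - ∑ j, y j), g (i.insertNth t y) := by
  have hm := (isClosed_stdSimplex (n + 1)).measurableSet
  have hi : Integrable ((stdSimplex (n + 1)).indicator g) :=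
    (hg.integrableOn_compact (isCompact_stdSimplex _)).integrable_indicator hm
  have e := (volume_preserving_piFinSuccAbove (fun _ : Fin (n + 1) => ℝ) i).symm
  rw [← integral_indicator hm, ← e.integral_comp', Measure.volume_eq_prod, integral_prod_symm,
    ← integral_indicator (isClosed_stdSimplex n).measurableSet]
  · refine integral_congr_ae (ae_of_all _ fun y => ?_)
    by_cases hy : y ∈ stdSimplex n
    · rw [indicator_of_mem hy, intervalIntegral.integral_of_le (by linarith [hy.2]),
        ← integral_Icc_eq_integral_Ioc, ← integral_indicator measurableSet_Icc]
      refine integral_congr_ae (ae_of_all _ fun t => ?_)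
      beta_reduce
      by_cases ht : t ∈ Icc 0 (1 - ∑ j, y j)
      · rw [indicator_of_mem ht]
        exact indicator_of_mem (insertNth_mem_stdSimplex.mpr ⟨hy, ht⟩) g
      · rw [indicator_of_notMem ht]
        exact indicator_of_notMem (fun h => ht (insertNth_mem_stdSimplex.mp h).2) g
    · rw [indicator_of_notMem hy]
      exact integral_eq_zero_of_ae (ae_of_all _ fun t =>
        indicator_of_notMem (fun h => hy (insertNth_mem_stdSimplex.mp h).1) g)
  · exact e.integrable_comp_of_integrable hi

/-- Each line in direction `i` meets the simplex in a segment running from the coordinate face to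
the slanted face; the fundamental theorem of calculus on these segments gives the two boundary
terms. -/
theorem setIntegral_fderiv_single {n : ℕ} (i : Fin (n + 1)) {f : (Fin (n + 1) → ℝ) → ℝ}
    {W : Set (Fin (n + 1) → ℝ)} (hW : IsOpen W) (hsW : stdSimplex (n + 1) ⊆ W)
    (hf : ContDiffOn ℝ 1 f W) :
    ∫ x in stdSimplex (n + 1), fderiv ℝ f x (Pi.single i 1) =
      (∫ y in stdSimplex n, f (i.insertNth (1 - ∑ j, y j) y)) -
        ∫ y in stdSimplex n, f (i.insertNth 0 y) := by
  have hd : ContinuousOn (fun x => fderiv ℝ f x (Pi.single i 1)) (stdSimplex (n + 1)) :=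
    ((hf.continuousOn_fderiv_of_isOpen hW le_rfl).mono hsW).clm_apply continuousOn_const
  have hc := hf.continuousOn.mono hsW
  have hins : Continuous fun p : ℝ × (Fin n → ℝ) => i.insertNth (α := fun _ => ℝ) p.1 p.2 :=
    Continuous.finInsertNth (A := fun _ => ℝ) i continuous_fst continuous_snd
  have hsum : Continuous fun y : Fin n → ℝ => 1 - ∑ j, y j := by fun_prop
  have hmem : ∀ y ∈ stdSimplex n, (0 : ℝ) ≤ 1 - ∑ j, y j := fun y hy => by linarith [hy.2]
  rw [setIntegral_stdSimplex_succ i hd, ← integral_sub]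
  · refine setIntegral_congr_fun (isClosed_stdSimplex n).measurableSet fun y hy => ?_
    have hline : ∀ t : ℝ, HasDerivAt (fun t : ℝ => i.insertNth (α := fun _ => ℝ) t y)
        (Pi.single i 1) t := fun t => by
      rw [hasDerivAt_pi]
      refine i.succAboveCases ?_ fun l => ?_
      · simpa using hasDerivAt_id' t
      · simpa using hasDerivAt_const t (y l)
    have hin : ∀ t ∈ uIcc 0 (1 - ∑ j, y j), i.insertNth t y ∈ stdSimplex (n + 1) := fun t ht =>
      insertNth_mem_stdSimplex.mpr ⟨hy, by rwa [uIcc_of_le (hmem y hy)] at ht⟩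
    refine intervalIntegral.integral_eq_sub_of_hasDerivAt
      (f := fun t => f (i.insertNth t y)) (fun t ht => ?_) ?_
    · have hx := (hf.contDiffAt (hW.mem_nhds (hsW (hin t ht)))).differentiableAt one_ne_zero
      exact hx.hasFDerivAt.comp_hasDerivAt t (hline t)
    · refine ContinuousOn.intervalIntegrable (hd.comp ?_ hin)
      exact (hins.comp (continuous_id.prodMk continuous_const)).continuousOn
  · refine ContinuousOn.integrableOn_compact (isCompact_stdSimplex n) (hc.comp ?_ fun y hy =>
      insertNth_mem_stdSimplex.mpr ⟨hy, hmem y hy, le_rfl⟩)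
    exact (hins.comp (hsum.prodMk continuous_id)).continuousOn
  · refine ContinuousOn.integrableOn_compact (isCompact_stdSimplex n) (hc.comp ?_ fun y hy =>
      insertNth_mem_stdSimplex.mpr ⟨hy, le_rfl, hmem y hy⟩)
    exact (hins.comp (continuous_const.prodMk continuous_id)).continuousOn

/-- The integral over the face opposite to the origin does not depend on the coordinate that is
eliminated. -/
theorem setIntegral_insertNth_one_sub_sum {n : ℕ} (i : Fin (n + 1)) {f : (Fin (n + 1) → ℝ) → ℝ}
    (hf : ContinuousOn f (stdSimplex (n + 1))) :
    ∫ y in stdSimplex n, f (i.insertNth (1 - ∑ j, y j) y) =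
      ∫ y in stdSimplex n, f ((0 : Fin (n + 1)).insertNth (1 - ∑ j, y j) y) := by
  have hc : ∀ i : Fin (n + 1), ContinuousOn (fun y : Fin n → ℝ =>
      f (i.insertNth (1 - ∑ j, y j) y)) (stdSimplex n) := fun i => by
    have hsum : Continuous fun y : Fin n → ℝ => 1 - ∑ j, y j := by fun_prop
    refine hf.comp (Continuous.finInsertNth (A := fun _ => ℝ) i hsum
      continuous_id).continuousOn fun y hy =>
      insertNth_mem_stdSimplex.mpr ⟨hy, by linarith [hy.2], le_rfl⟩
  refine Fin.cases rfl (fun i => ?_) i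
  obtain ⟨n, rfl⟩ : ∃ k, n = k + 1 := ⟨n - 1, by have := i.pos; omega⟩
  -- With the other coordinates `y` fixed, coordinates `0` and `i.succ` are `t` and `1 - ∑ y - t` on
  -- the left, and the reverse on the right. The reflection `t ↦ 1 - ∑ y - t` therefore identifies
  -- the inner integrals.
  rw [setIntegral_stdSimplex_succ 0 (hc i.succ), setIntegral_stdSimplex_succ i (hc 0)]
  refine setIntegral_congr_fun (isClosed_stdSimplex n).measurableSet fun y _ => ?_
  have := intervalIntegral.integral_comp_sub_left (a := 0) (b := 1 - ∑ j, y j)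
    (fun t => f ((0 : Fin (n + 2)).insertNth t (i.insertNth (1 - ∑ j, y j - t) y)))
    (1 - ∑ j, y j)
  simp only [sub_self, sub_zero, sub_sub_cancel] at this
  have h1 : ∀ t : ℝ, i.succ.insertNth (1 - ∑ j, (0 : Fin (n + 1)).insertNth (α := fun _ => ℝ) t y j)
      ((0 : Fin (n + 1)).insertNth (α := fun _ => ℝ) t y) =
      (0 : Fin (n + 2)).insertNth (α := fun _ => ℝ) t (i.insertNth (1 - ∑ j, y j - t) y) := by
    intro t
    rw [Fin.sum_univ_succAbove _ 0]
    simp [sub_sub, add_comm]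
  have h2 : ∀ t : ℝ, 1 - ∑ j, i.insertNth (α := fun _ => ℝ) t y j = 1 - ∑ j, y j - t := fun t => by
    rw [Fin.sum_univ_succAbove _ i]
    simp [sub_sub, add_comm]
  simp only [h1, h2]
  exact this.symm

/-- Stokes' theorem for a differential form near the standard simplex. -/
theorem setIntegral_extDeriv_stdSimplex {n : ℕ}
    {η : (Fin (n + 1) → ℝ) → (Fin (n + 1) → ℝ) [⋀^Fin n]→L[ℝ] ℝ}
    {W : Set (Fin (n + 1) → ℝ)} (hW : IsOpen W) (hsW : stdSimplex (n + 1) ⊆ W)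
    (hη : ∀ x ∈ W, DifferentiableAt ℝ η x) (hη' : ∀ v, ContDiffOn ℝ 1 (fun x => η x v) W) :
    ∫ x in stdSimplex (n + 1), extDeriv η x (fun i => Pi.single i 1) =
      ∑ i : Fin (n + 2), (-1 : ℝ) ^ (i : ℕ) * ∫ y in stdSimplex n,
        η (faceMap i y) fun k => fderiv ℝ (faceMap i) y (Pi.single k 1) := by
  -- `f i` is the coefficient of `η` at the basis form in which `dx^i` is missing.
  set f : Fin (n + 1) → (Fin (n + 1) → ℝ) → ℝ :=
    fun i x => η x fun k => Pi.single (i.succAbove k) 1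
  have hf : ∀ i, ContDiffOn ℝ 1 (f i) W := fun i => hη' _
  have hc : ∀ i, ContinuousOn (f i) (stdSimplex (n + 1)) := fun i => (hf i).continuousOn.mono hsW
  have hd : ∀ i : Fin (n + 1), ContinuousOn (fun x => fderiv ℝ (f i) x (Pi.single i 1))
      (stdSimplex (n + 1)) := fun i =>
    (((hf i).continuousOn_fderiv_of_isOpen hW le_rfl).mono hsW).clm_apply continuousOn_const
  have hL : ∫ x in stdSimplex (n + 1), extDeriv η x (fun i => Pi.single i 1) =
      ∑ i : Fin (n + 1), (-1 : ℝ) ^ (i : ℕ) *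
        ∫ x in stdSimplex (n + 1), fderiv ℝ (f i) x (Pi.single i 1) := by
    simp_rw [← integral_const_mul]
    rw [← integral_finsetSum]
    · refine setIntegral_congr_fun (isClosed_stdSimplex _).measurableSet fun x hx => ?_
      refine (extDeriv_apply (hη x (hsW hx)) _).trans ?_
      simp only [zsmul_eq_mul, Int.cast_pow, Int.cast_neg, Int.cast_one]
      rfl
    · exact fun i _ => ((hd i).integrableOn_compact (isCompact_stdSimplex _)).const_mul _
  have h0 : ∫ y in stdSimplex n, η (faceMap 0 y) (fun k => fderiv ℝ (faceMap 0) y (Pi.single k 1)) =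
      ∑ i : Fin (n + 1), (-1 : ℝ) ^ (i : ℕ) * ∫ y in stdSimplex n, f i (faceMap 0 y) := by
    simp_rw [← integral_const_mul]
    rw [← integral_finsetSum]
    · simp only [fderiv_faceMap_zero, alternating_apply_single_sub_single, f]
    · intro i _
      have : ContinuousOn (fun y => f i (faceMap 0 y)) (stdSimplex n) :=
        (hc i).comp (contDiff_faceMap 0).continuous.continuousOn fun y hy => faceMap_mem 0 hy
      exact (this.integrableOn_compact (isCompact_stdSimplex _)).const_mul _
  rw [hL, Fin.sum_univ_succ (n := n + 1), h0]
  simp only [Fin.val_zero, pow_zero, one_mul, Fin.val_succ, fderiv_faceMap_succ, faceMap_succ,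
    faceMap_zero]
  -- Face `0` supplies the slanted integrals with sign `(-1)^i`, and face `i + 1` the coordinate
  -- integral with sign `(-1)^(i+1)`, so the two sides match coordinate by coordinate.
  rw [← Finset.sum_add_distrib]
  refine Finset.sum_congr rfl fun i _ => ?_
  rw [setIntegral_fderiv_single i hW hsW (hf i), setIntegral_insertNth_one_sub_sum i (hc i)]
  simp only [f]
  ring

/-- All tangent spaces of `M` are definitionally the model space. With a fixed `F`, the base point
and the linear map can be replaced together without dependent rewriting. -/
theorem compContinuousLinearMap_congr {X E F : Type*} [AddCommGroup E] [Module ℝ E]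
    [TopologicalSpace E] [AddCommGroup F] [Module ℝ F] [TopologicalSpace F] {n : ℕ}
    (η : X → F [⋀^Fin n]→L[ℝ] ℝ) {p q : X} (h : p = q) {A B : E →L[ℝ] F} (hAB : A = B) :
    (η p).compContinuousLinearMap A = (η q).compContinuousLinearMap B := by
  rw [h, hAB]

/-! ### Pullback of forms from the manifold to Euclidean space -/

section Pullback

variable {m : ℕ} {M : Type*} [TopologicalSpace M] [ChartedSpace (EuclideanSpace ℝ (Fin m)) M]

/-- The pullback of a differential form on `M` under a map from `ℝ^k` to `M`. -/
noncomputable def DiffForm.pullback {k n : ℕ} (σ : (Fin k → ℝ) → M) (η : DiffForm m M n) :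
    (Fin k → ℝ) → (Fin k → ℝ) [⋀^Fin n]→L[ℝ] ℝ :=
  fun x => (η (σ x)).compContinuousLinearMap (mfderiv 𝓘(ℝ, Fin k → ℝ) (𝓡 m) σ x)

theorem DiffForm.IsSmooth.contDiffAt_inChart {n : ℕ} {η : DiffForm m M n}
    (hη : DiffForm.IsSmooth η) (p : M) :
    ContDiffAt ℝ ∞ (DiffForm.inChart η p) (extChartAt (𝓡 m) p p) :=
  (hη p).contDiffAt ((isOpen_extChartAt_target p).mem_nhds (mem_extChartAt_target p))

theorem isOpen_inter_preimage_source {k : ℕ} {σ : (Fin k → ℝ) → M} {W : Set (Fin k → ℝ)}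
    (hW : IsOpen W) (hσ : ContMDiffOn 𝓘(ℝ, Fin k → ℝ) (𝓡 m) ∞ σ W) (p : M) :
    IsOpen (W ∩ σ ⁻¹' (chartAt (EuclideanSpace ℝ (Fin m)) p).source) :=
  hσ.continuousOn.isOpen_inter_preimage hW (chartAt _ p).open_source

variable [IsManifold (𝓡 m) ∞ M] {k n : ℕ} {σ : (Fin k → ℝ) → M} {W : Set (Fin k → ℝ)}

theorem contDiffOn_extChartAt_comp
    (hσ : ContMDiffOn 𝓘(ℝ, Fin k → ℝ) (𝓡 m) ∞ σ W) (p : M) :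
    ContDiffOn ℝ ∞ (extChartAt (𝓡 m) p ∘ σ)
      (W ∩ σ ⁻¹' (chartAt (EuclideanSpace ℝ (Fin m)) p).source) := by
  rw [← contMDiffOn_iff_contDiffOn]
  exact (contMDiffOn_extChartAt (x := p)).comp (hσ.mono inter_subset_left) fun x hx => hx.2

/-- Where `σ` stays in the chart domain it equals the inverse chart after the coordinate expression
of `σ`, and the chain rule splits its derivative accordingly. Questions about the pullback thus
become questions in vector spaces. -/
theorem DiffForm.pullback_eq_inChart (hW : IsOpen W)
    (hσ : ContMDiffOn 𝓘(ℝ, Fin k → ℝ) (𝓡 m) ∞ σ W) (η : DiffForm m M n) (p : M)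
    {x : Fin k → ℝ} (hx : x ∈ W ∩ σ ⁻¹' (chartAt (EuclideanSpace ℝ (Fin m)) p).source) :
    DiffForm.pullback σ η x =
      (DiffForm.inChart η p ((extChartAt (𝓡 m) p ∘ σ) x)).compContinuousLinearMap
        (fderiv ℝ (extChartAt (𝓡 m) p ∘ σ) x) := by
  have hU := isOpen_inter_preimage_source hW hσ p
  have hinv : ∀ y ∈ W ∩ σ ⁻¹' (chartAt (EuclideanSpace ℝ (Fin m)) p).source,
      (extChartAt (𝓡 m) p).symm (extChartAt (𝓡 m) p (σ y)) = σ y := fun y hy =>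
    (extChartAt (𝓡 m) p).left_inv (by rw [extChartAt_source]; exact hy.2)
  have htgt : extChartAt (𝓡 m) p (σ x) ∈ (extChartAt (𝓡 m) p).target :=
    (extChartAt (𝓡 m) p).map_source (by rw [extChartAt_source]; exact hx.2)
  have hg : MDifferentiableAt 𝓘(ℝ, Fin k → ℝ) 𝓘(ℝ, EuclideanSpace ℝ (Fin m))
      (extChartAt (𝓡 m) p ∘ σ) x :=
    (((contDiffOn_extChartAt_comp hσ p).contDiffAt (hU.mem_nhds hx)).differentiableAt
      (by simp)).mdifferentiableAt
  have hs : MDifferentiableAt 𝓘(ℝ, EuclideanSpace ℝ (Fin m)) (𝓡 m) (extChartAt (𝓡 m) p).symm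
      ((extChartAt (𝓡 m) p ∘ σ) x) :=
    (mdifferentiableOn_extChartAt_symm _ htgt).mdifferentiableAt
      ((isOpen_extChartAt_target p).mem_nhds htgt)
  let S : (Fin k → ℝ) →L[ℝ] EuclideanSpace ℝ (Fin m) := mfderiv 𝓘(ℝ, Fin k → ℝ) (𝓡 m) σ x
  let D : EuclideanSpace ℝ (Fin m) →L[ℝ] EuclideanSpace ℝ (Fin m) :=
    mfderiv 𝓘(ℝ, EuclideanSpace ℝ (Fin m)) (𝓡 m) (extChartAt (𝓡 m) p).symm
      ((extChartAt (𝓡 m) p ∘ σ) x)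
  have hderiv : S = D.comp (fderiv ℝ (extChartAt (𝓡 m) p ∘ σ) x) := by
    have h1 : (extChartAt (𝓡 m) p).symm ∘ (extChartAt (𝓡 m) p ∘ σ) =ᶠ[𝓝 x] σ := by
      filter_upwards [hU.mem_nhds hx] with y hy using hinv y hy
    exact h1.mfderiv_eq.symm.trans
      ((mfderiv_comp x hs hg).trans (congrArg D.comp mfderiv_eq_fderiv))
  exact compContinuousLinearMap_congr η (hinv x hx).symm hderiv

/-- Pulling back is linear in the form and is a continuous multilinear map on the diagonal in the
linear map, hence smooth in both jointly. -/
theorem _root_.ContDiffAt.continuousAlternatingMap_comp_apply {E F G : Type*}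
    [NormedAddCommGroup E] [NormedSpace ℝ E] [NormedAddCommGroup F] [NormedSpace ℝ F]
    [NormedAddCommGroup G] [NormedSpace ℝ G] {N : WithTop ℕ∞} {f : G → F [⋀^Fin n]→L[ℝ] ℝ}
    {g : G → E →L[ℝ] F} {x : G} (hf : ContDiffAt ℝ N f x) (hg : ContDiffAt ℝ N g x)
    (v : Fin n → E) : ContDiffAt ℝ N (fun y => (f y).compContinuousLinearMap (g y) v) x := by
  have h1 : ContDiffAt ℝ N (fun y =>
      ContinuousMultilinearMap.compContinuousLinearMapContinuousMultilinear ℝ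
        (fun _ : Fin n => E) (fun _ => F) ℝ (fun _ => g y)) x :=
    (ContinuousMultilinearMap.contDiff _).contDiffAt.comp x (contDiffAt_pi.mpr fun _ => hg)
  have h2 : ContDiffAt ℝ N (fun y =>
      ContinuousAlternatingMap.toContinuousMultilinearMapCLM ℝ (f y)) x :=
    (ContinuousLinearMap.contDiff _).contDiffAt.comp x hf
  exact (ContinuousMultilinearMap.apply ℝ (fun _ : Fin n => E) ℝ v).contDiff.contDiffAt.comp x
    (h1.clm_apply h2)

theorem contDiffAt_extChartAt_comp (hW : IsOpen W)
    (hσ : ContMDiffOn 𝓘(ℝ, Fin k → ℝ) (𝓡 m) ∞ σ W) {x : Fin k → ℝ} (hx : x ∈ W) :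
    ContDiffAt ℝ ∞ (extChartAt (𝓡 m) (σ x) ∘ σ) x :=
  (contDiffOn_extChartAt_comp hσ (σ x)).contDiffAt
    ((isOpen_inter_preimage_source hW hσ (σ x)).mem_nhds ⟨hx, mem_chart_source _ _⟩)

/-- The chart stays fixed at `σ x` while `y` varies, so the identity may be differentiated at `x`;
it is also the chart in which `DiffForm.d` is computed at `σ x`. -/
theorem DiffForm.pullback_eventuallyEq (hW : IsOpen W)
    (hσ : ContMDiffOn 𝓘(ℝ, Fin k → ℝ) (𝓡 m) ∞ σ W) (η : DiffForm m M n)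
    {x : Fin k → ℝ} (hx : x ∈ W) :
    DiffForm.pullback σ η =ᶠ[𝓝 x] fun y =>
      (DiffForm.inChart η (σ x) ((extChartAt (𝓡 m) (σ x) ∘ σ) y)).compContinuousLinearMap
        (fderiv ℝ (extChartAt (𝓡 m) (σ x) ∘ σ) y) := by
  filter_upwards [(isOpen_inter_preimage_source hW hσ (σ x)).mem_nhds
    ⟨hx, mem_chart_source _ _⟩] with y hy
  exact DiffForm.pullback_eq_inChart hW hσ η (σ x) hy

theorem DiffForm.contDiffAt_pullback_apply (hW : IsOpen W)
    (hσ : ContMDiffOn 𝓘(ℝ, Fin k → ℝ) (𝓡 m) ∞ σ W) {η : DiffForm m M n}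
    (hη : DiffForm.IsSmooth η) {x : Fin k → ℝ} (hx : x ∈ W) (v : Fin n → Fin k → ℝ) :
    ContDiffAt ℝ ∞ (fun y => DiffForm.pullback σ η y v) x := by
  have hg := contDiffAt_extChartAt_comp hW hσ hx
  have h1 : ContDiffAt ℝ ∞ (fun y => DiffForm.inChart η (σ x) ((extChartAt (𝓡 m) (σ x) ∘ σ) y)) x :=
    ContDiffAt.comp (g := DiffForm.inChart η (σ x)) x (hη.contDiffAt_inChart (σ x)) hg
  refine (h1.continuousAlternatingMap_comp_apply
    (hg.fderiv_right le_rfl) v).congr_of_eventuallyEq ?_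
  filter_upwards [DiffForm.pullback_eventuallyEq hW hσ η hx] with y hy using by rw [hy]

theorem DiffForm.differentiableAt_pullback (hW : IsOpen W)
    (hσ : ContMDiffOn 𝓘(ℝ, Fin k → ℝ) (𝓡 m) ∞ σ W) {η : DiffForm m M n}
    (hη : DiffForm.IsSmooth η) {x : Fin k → ℝ} (hx : x ∈ W) :
    DifferentiableAt ℝ (DiffForm.pullback σ η) x := by
  have hg := contDiffAt_extChartAt_comp hW hσ hx
  have h1 : ContDiffAt ℝ ∞ (fun y => DiffForm.inChart η (σ x) ((extChartAt (𝓡 m) (σ x) ∘ σ) y)) x :=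
    ContDiffAt.comp (g := DiffForm.inChart η (σ x)) x (hη.contDiffAt_inChart (σ x)) hg
  have h2 : ContDiffAt ℝ ∞ (fderiv ℝ (extChartAt (𝓡 m) (σ x) ∘ σ)) x := hg.fderiv_right le_rfl
  exact ((h1.differentiableAt (by simp)).continuousAlternatingMapCompContinuousLinearMap
    (h2.differentiableAt (by simp))).congr_of_eventuallyEq
      (DiffForm.pullback_eventuallyEq hW hσ η hx)

/-- The exterior derivative commutes with pullback. -/
theorem DiffForm.extDeriv_pullback (hW : IsOpen W)
    (hσ : ContMDiffOn 𝓘(ℝ, Fin k → ℝ) (𝓡 m) ∞ σ W) {η : DiffForm m M n}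
    (hη : DiffForm.IsSmooth η) {x : Fin k → ℝ} (hx : x ∈ W) :
    extDeriv (DiffForm.pullback σ η) x = DiffForm.pullback σ (DiffForm.d η) x := by
  have hg := contDiffAt_extChartAt_comp hW hσ hx
  have hs : MDifferentiableAt 𝓘(ℝ, Fin k → ℝ) (𝓡 m) σ x :=
    (hσ.contMDiffAt (hW.mem_nhds hx)).mdifferentiableAt (by simp)
  have hφ : MDifferentiableAt (𝓡 m) 𝓘(ℝ, EuclideanSpace ℝ (Fin m)) (extChartAt (𝓡 m) (σ x)) (σ x) :=
    mdifferentiableAt_extChartAt (mem_chart_source _ (σ x))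
  have hderiv := mfderiv_eq_fderiv.symm.trans (mfderiv_comp x hφ hs)
  have hd : DifferentiableAt ℝ (DiffForm.inChart η (σ x)) ((extChartAt (𝓡 m) (σ x) ∘ σ) x) :=
    (hη.contDiffAt_inChart (σ x)).differentiableAt (by simp)
  refine (DiffForm.pullback_eventuallyEq hW hσ η hx).extDeriv_eq.trans
    ((_root_.extDeriv_pullback hd hg ?_).trans ?_)
  -- The Euclidean pullback rule needs the map to be only `C²`.
  · rw [minSmoothness_of_isRCLikeNormedField]
    exact WithTop.coe_le_coe.mpr (le_top : (2 : ℕ∞) ≤ ⊤)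
  exact congrArg (ContinuousAlternatingMap.compContinuousLinearMap
    (extDeriv (DiffForm.inChart η (σ x)) (extChartAt (𝓡 m) (σ x) (σ x)))) hderiv

end Pullback

/-! ### Stokes' theorem for simplices and chains -/

section Stokes

variable {m : ℕ} {M : Type*} [TopologicalSpace M] [ChartedSpace (EuclideanSpace ℝ (Fin m)) M]

/-- The integral of `ln α` over the simplex `σ`, the logarithm of the product integral. -/
noncomputable def Simplex.logIntegral {n : ℕ} (σ : Simplex m M n) (α : ProductForm m M n) : ℝ :=
  ∫ x in stdSimplex n, PosReal.ln (σ.coeff α x)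

theorem Simplex.ln_coeff {n : ℕ} (σ : Simplex m M n) (α : ProductForm m M n) (x : Fin n → ℝ) :
    PosReal.ln (σ.coeff α x) =
      DiffForm.pullback σ.toFun (ProductForm.ln α) x fun i => Pi.single i 1 :=
  rfl

theorem DiffForm.ln_exp {n : ℕ} (η : DiffForm m M n) : ProductForm.ln (DiffForm.exp η) = η := by
  funext x
  refine ContinuousAlternatingMap.ext fun v => ?_
  exact Real.log_exp _

theorem Simplex.ln_coeff_q {n : ℕ} (σ : Simplex m M (n + 1)) (α : ProductForm m M n)
    (x : Fin (n + 1) → ℝ) :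
    PosReal.ln (σ.coeff (ProductForm.q α) x) =
      DiffForm.pullback σ.toFun (DiffForm.d (ProductForm.ln α)) x fun i => Pi.single i 1 := by
  rw [σ.ln_coeff, ProductForm.q, DiffForm.ln_exp]

/-- This is functoriality of pullback, by the chain rule. It is restricted to the simplex because
`σ` is known to be differentiable only near its domain simplex. -/
theorem DiffForm.pullback_face {n k : ℕ} (σ : Simplex m M (n + 1)) (η : DiffForm m M k)
    (i : Fin (n + 2)) {x : Fin n → ℝ} (hx : x ∈ stdSimplex n) :
    DiffForm.pullback (σ.face i).toFun η x =
      (DiffForm.pullback σ.toFun η (faceMap i x)).compContinuousLinearMap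
        (fderiv ℝ (faceMap i) x) := by
  obtain ⟨W, hW, hsW, hσ⟩ := σ.smooth
  have hs : MDifferentiableAt 𝓘(ℝ, Fin (n + 1) → ℝ) (𝓡 m) σ.toFun (faceMap i x) :=
    (hσ.contMDiffAt (hW.mem_nhds (hsW (faceMap_mem i hx)))).mdifferentiableAt (by simp)
  have hf : MDifferentiableAt 𝓘(ℝ, Fin n → ℝ) 𝓘(ℝ, Fin (n + 1) → ℝ) (faceMap i) x :=
    ((contDiff_faceMap i).differentiable (by simp) x).mdifferentiableAt
  have hderiv := mfderiv_comp x hs hf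
  rw [mfderiv_eq_fderiv] at hderiv
  exact congrArg (ContinuousAlternatingMap.compContinuousLinearMap (η (σ.toFun (faceMap i x))))
    hderiv

theorem Simplex.prodIntegral_eq_exp {n : ℕ} (σ : Simplex m M n) {α : ProductForm m M n}
    (h : ContinuousOn (fun x => PosReal.ln (σ.coeff α x)) (stdSimplex n)) :
    σ.prodIntegral α = Real.exp (σ.logIntegral α) :=
  ProductCalculus.prodIntegral_eq_exp h

/-- The logarithm of the product integral is a linear functional of the chain, so boundaries can be
expanded by linearity even when faces coincide or cancel. -/
theorem Chain.prodIntegral_eq_exp {n : ℕ} (c : Chain m M n) {α : ProductForm m M n}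
    (h : ∀ σ : Simplex m M n,
      ContinuousOn (fun x => PosReal.ln (σ.coeff α x)) (stdSimplex n)) :
    c.prodIntegral α =
      Real.exp (Finsupp.linearCombination ℝ (fun σ => σ.logIntegral α) c) := by
  rw [Chain.prodIntegral, Finsupp.linearCombination_apply, Finsupp.sum, Real.exp_sum]
  refine Finset.prod_congr rfl fun σ _ => ?_
  beta_reduce
  rw [σ.prodIntegral_eq_exp (h σ), ← Real.exp_mul, smul_eq_mul, mul_comm]

variable [IsManifold (𝓡 m) ∞ M]

theorem Simplex.continuousOn_ln_coeff {n : ℕ} (σ : Simplex m M n) {α : ProductForm m M n}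
    (hα : ProductForm.IsSmooth α) :
    ContinuousOn (fun x => PosReal.ln (σ.coeff α x)) (stdSimplex n) := by
  obtain ⟨W, hW, hsW, hσ⟩ := σ.smooth
  exact fun x hx => (DiffForm.contDiffAt_pullback_apply hW hσ hα
    (hsW hx) _).continuousAt.continuousWithinAt

/-- Smoothness of `q α` on `M` is not needed: its logarithmic coefficient is the exterior derivative
of the pulled-back form, an alternating sum of continuous partial derivatives. -/
theorem Simplex.continuousOn_ln_coeff_q {n : ℕ} (σ : Simplex m M (n + 1)) {α : ProductForm m M n}
    (hα : ProductForm.IsSmooth α) :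
    ContinuousOn (fun x => PosReal.ln (σ.coeff (ProductForm.q α) x)) (stdSimplex (n + 1)) := by
  obtain ⟨W, hW, hsW, hσ⟩ := σ.smooth
  have h : ContinuousOn (fun x => ∑ i : Fin (n + 1), (-1 : ℤ) ^ (i : ℕ) •
      fderiv ℝ (fun y => DiffForm.pullback σ.toFun (ProductForm.ln α) y
        fun j => Pi.single (i.succAbove j) 1) x (Pi.single i 1)) (stdSimplex (n + 1)) := by
    refine continuousOn_finsetSum _ fun i _ x hx => ContinuousAt.continuousWithinAt ?_
    have hc := (DiffForm.contDiffAt_pullback_apply hW hσ hα (hsW hx)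
      fun j => Pi.single (i.succAbove j) 1).fderiv_right (m := 0) (by simp)
    refine ContinuousAt.const_smul ?_ ((-1 : ℤ) ^ (i : ℕ))
    exact hc.continuousAt.clm_apply continuousAt_const
  refine h.congr fun x hx => ?_
  rw [σ.ln_coeff_q, ← DiffForm.extDeriv_pullback hW hσ hα (hsW hx)]
  exact extDeriv_apply (DiffForm.differentiableAt_pullback hW hσ hα (hsW hx)) _

/-- Stokes' theorem over a simplex, in logarithmic form. -/
theorem Simplex.logIntegral_q {n : ℕ} (σ : Simplex m M (n + 1)) {α : ProductForm m M n}
    (hα : ProductForm.IsSmooth α) :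
    σ.logIntegral (ProductForm.q α) =
      ∑ i : Fin (n + 2), (-1 : ℝ) ^ (i : ℕ) * (σ.face i).logIntegral α := by
  obtain ⟨W, hW, hsW, hσ⟩ := σ.smooth
  have h := setIntegral_extDeriv_stdSimplex hW hsW
    (fun x hx => DiffForm.differentiableAt_pullback hW hσ hα hx)
    (fun v x hx => ((DiffForm.contDiffAt_pullback_apply hW hσ hα hx v).of_le
      (by simp)).contDiffWithinAt)
  refine Eq.trans ?_ (h.trans (Finset.sum_congr rfl fun i _ => congrArg _ ?_))
  · refine setIntegral_congr_fun (isClosed_stdSimplex _).measurableSet fun x hx => ?_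
    rw [σ.ln_coeff_q, DiffForm.extDeriv_pullback hW hσ hα (hsW hx)]
  · refine setIntegral_congr_fun (isClosed_stdSimplex _).measurableSet fun x hx => ?_
    rw [(σ.face i).ln_coeff, DiffForm.pullback_face σ _ i hx]
    rfl

end Stokes

end ProductCalculus

theorem mainTheorem1 (m n : ℕ) (M : Type*) [TopologicalSpace M]
    [ChartedSpace (EuclideanSpace ℝ (Fin m)) M] [IsManifold (𝓡 m) ∞ M]
    (c : ProductCalculus.Chain m M (n + 1))
    (α : ProductCalculus.ProductForm m M n) (hα : ProductCalculus.ProductForm.IsSmooth α) :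
    ProductCalculus.Chain.ProdIntegrable (ProductCalculus.Chain.boundary c) α ∧
    ProductCalculus.Chain.ProdIntegrable c (ProductCalculus.ProductForm.q α) ∧
    ProductCalculus.Chain.prodIntegral (ProductCalculus.Chain.boundary c) α =
      ProductCalculus.Chain.prodIntegral c (ProductCalculus.ProductForm.q α) := by
  have h := fun σ : ProductCalculus.Simplex m M n => σ.continuousOn_ln_coeff hα
  have hq := fun σ : ProductCalculus.Simplex m M (n + 1) => σ.continuousOn_ln_coeff_q hα
  refine ⟨fun σ _ => ProductCalculus.prodIntegrable_of_continuousOn (h σ),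
    fun σ _ => ProductCalculus.prodIntegrable_of_continuousOn (hq σ), ?_⟩
  rw [ProductCalculus.Chain.prodIntegral_eq_exp _ h, ProductCalculus.Chain.prodIntegral_eq_exp _ hq]
  -- After removing the exponential, both sides are linear in `c`, and the identity is checked
  -- simplex by simplex.
  congr 1
  rw [ProductCalculus.Chain.boundary, Finsupp.sum, map_sum, Finsupp.linearCombination_apply,
    Finsupp.sum]
  refine Finset.sum_congr rfl fun σ _ => ?_
  rw [map_smul, map_sum, σ.logIntegral_q hα]
  simp only [Finsupp.linearCombination_single, smul_eq_mul]
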